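/- Let $\mathbb N=\{1,2,3,\dots\}$ and $\omega=\{0,1,2,\dots\}$. Let $\beta\mathbb N$ be the set of ultrafilters on $\mathbb N$, with the associative operation $+$ given by $$X\in p+q\iff\{a\in\mathbb N:\{b\in\mathbb N:a+b\in X\}\in q\}\in p\qquad(X\subseteq\mathbb N),$$ and let $K(\beta\mathbb N)$ be the smallest two-sided ideal of $(\beta\mathbb N,+)$. A set $C\subseteq\mathbb N$ is called central if $C\in p$ for some $p\in K(\beta\mathbb N)$ with $p+p=p$. Let $A=(a_{i,j})_{i,j\in\omega}$ be the $\omega\times\omega$ matrix with $$a_{i,j}=\begin{cases}2&\text{if }j=i,\\1&\text{if }2^i\le j<2^{i+1},\\0&\text{otherwise,}\end{cases}$$ and let $I$ be the $\omega\times\omega$ identity matrix. **Corollary.** For every central set $C\subseteq\mathbb N$ there exist sequences $\vec x=(x_n)_{n\in\omega}$ and $\vec y=(y_n)_{n\in\omega}$ of elements of $C$ such that $$\begin{pmatrix}A&-I\end{pmatrix}\begin{pmatrix}\vec x\\ \vec y\end{pmatrix}=\vec 0,$$ that is, $2x_n+x_{2^n}+x_{2^n+1}+\cdots+x_{2^{n+1}-1}=y_n$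 for every $n\in\omega$, and such that all the entries of $\begin{pmatrix}\vec x\\ \vec y\end{pmatrix}$ are distinct: $x_m\ne x_n$ and $y_m\ne y_n$ whenever $m\ne n$, and $x_m\ne y_n$ for all $m,n\in\omega$. -/

import Mathlib

namespace CentralSystem

section Central

/- `Ultrafilter S` is the Stone–Čech compactification `βS` of the discrete semigroup `S`; the
addition `Ultrafilter.add` satisfies
`A ∈ p + q ↔ {x | {y | x + y ∈ A} ∈ q} ∈ p`. -/
attribute [local instance] Ultrafilter.addSemigroup

/-- A (nonempty) two-sided ideal of a semigroup `T`, written additively. -/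
structure IsTwoSidedIdeal {T : Type*} [AddSemigroup T] (I : Set T) : Prop where
  nonempty : I.Nonempty
  add_mem_left : ∀ (t : T) {a : T}, a ∈ I → t + a ∈ I
  add_mem_right : ∀ (t : T) {a : T}, a ∈ I → a + t ∈ I

/-- `K(T)`: the intersection of all two-sided ideals of `T`. This is the smallest two-sided ideal
of `T` whenever there is one, in particular for `T = βS`: see `isLeast_smallestIdeal`. -/
def smallestIdeal (T : Type*) [AddSemigroup T] : Set T :=
  ⋂₀ {I : Set T | IsTwoSidedIdeal I}

/-- `C ⊆ S` is central: it is a member of some idempotent of `βS` lying in `K(βS)`. -/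
def IsCentral {S : Type*} [AddSemigroup S] (C : Set S) : Prop :=
  ∃ p : Ultrafilter S, p ∈ smallestIdeal (Ultrafilter S) ∧ p + p = p ∧ C ∈ p

/-- `βS` really has a smallest two-sided ideal, namely `smallestIdeal (βS)`. -/
theorem isLeast_smallestIdeal (S : Type*) [AddSemigroup S] [Nonempty S] :
    IsLeast {I : Set (Ultrafilter S) | IsTwoSidedIdeal I} (smallestIdeal (Ultrafilter S)) := by
  refine ⟨⟨?_, fun t a ha I hI => hI.add_mem_left t (ha I hI),
    fun t a ha I hI => hI.add_mem_right t (ha I hI)⟩, fun I hI => Set.sInter_subset_of_mem hI⟩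
  let F : Set (Set (Ultrafilter S)) :=
    {L | IsClosed L ∧ L.Nonempty ∧ ∀ t : Ultrafilter S, ∀ a ∈ L, t + a ∈ L}
  obtain ⟨L, hL⟩ : ∃ L, Minimal (· ∈ F) L := by
    refine zorn_superset F fun c hcF hc => ?_
    rcases c.eq_empty_or_nonempty with rfl | hne
    · exact ⟨Set.univ, ⟨isClosed_univ, Set.univ_nonempty, fun _ _ _ => trivial⟩, by simp⟩
    · refine ⟨⋂₀ c, ⟨isClosed_sInter fun s hs => (hcF hs).1, ?_,
        fun t a ha s hs => (hcF hs).2.2 t a (ha s hs)⟩, fun s hs => Set.sInter_subset_of_mem hs⟩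
      have : Nonempty c := hne.to_subtype
      rw [Set.sInter_eq_iInter]
      refine IsCompact.nonempty_iInter_of_directed_nonempty_isCompact_isClosed _
        (fun s t => ?_) (fun s => (hcF s.2).2.1)
        (fun s => (hcF s.2).1.isCompact) (fun s => (hcF s.2).1)
      rcases hc.total s.2 t.2 with h | h
      · exact ⟨s, subset_rfl, h⟩
      · exact ⟨t, h, subset_rfl⟩
  obtain ⟨l, hl⟩ := hL.prop.2.1
  refine ⟨l, fun I hI => ?_⟩
  obtain ⟨i, hi⟩ := hI.nonempty
  have hmem : Set.range (· + (i + l)) ∈ F := by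
    refine ⟨(isCompact_range (Ultrafilter.continuous_add_left _)).isClosed,
      ⟨_, i, rfl⟩, ?_⟩
    rintro t _ ⟨a, rfl⟩
    exact ⟨t + a, add_assoc _ _ _⟩
  have hsub : Set.range (· + (i + l)) ⊆ L := by
    rintro _ ⟨a, rfl⟩
    exact hL.prop.2.2 _ _ (hL.prop.2.2 _ _ hl)
  obtain ⟨a, ha⟩ := hL.le_of_le hmem hsub hl
  rw [← ha]
  exact hI.add_mem_left _ (hI.add_mem_right _ hi)

end Central

section System

/-- The product `M v` of a row-finite matrix and a vector: the entry with index `i` is the finite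
sum `∑ⱼ Mᵢⱼ vⱼ`. -/
noncomputable def mulVecRowFinite {m n : Type*} (M : Matrix m n ℚ) (v : n → ℚ) : m → ℚ :=
  fun i => ∑ᶠ j, M i j * v j

/-- The `ω × ω` matrix `A` with `a i j = 2` if `j = i`, `a i j = 1` if `2 ^ i ≤ j < 2 ^ (i + 1)`,
and `a i j = 0` otherwise. -/
def matA : Matrix ℕ ℕ ℚ :=
  Matrix.of fun i j => if j = i then 2 else if 2 ^ i ≤ j ∧ j < 2 ^ (i + 1) then 1 else 0

/-- The `ω × (ω + ω)` coefficient matrix `(A  -I)`. -/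
def coeffMatrix : Matrix ℕ (ℕ ⊕ ℕ) ℚ :=
  Matrix.fromCols matA (-1)

/-- Each row of `(A  -I)` has finitely many nonzero entries, so the sums in
`mulVecRowFinite coeffMatrix v` are finite sums. -/
theorem coeffMatrix_row_finite (i : ℕ) : (Function.support (coeffMatrix i)).Finite := by
  refine (((Finset.range (2 ^ (i + 1))).disjSum {i}).finite_toSet).subset ?_
  have hi : i < 2 ^ (i + 1) := i.lt_two_pow_self.trans (Nat.pow_lt_pow_right (by norm_num) (by simp))
  rintro (j | j) hj
  · simp only [coeffMatrix, matA, Function.mem_support, Matrix.fromCols_apply_inl,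
      Matrix.of_apply] at hj
    simp only [Finset.mem_coe, Finset.inl_mem_disjSum, Finset.mem_range]
    by_contra h
    apply hj
    rw [if_neg (by omega), if_neg (fun h' => h h'.2)]
  · simp only [coeffMatrix, Function.mem_support, Matrix.fromCols_apply_inr, Matrix.neg_apply,
      Matrix.one_apply] at hj
    simp only [Finset.mem_coe, Finset.inr_mem_disjSum, Finset.mem_singleton]
    by_contra h
    exact hj (by rw [if_neg (fun h' => h h'.symm)]; simp)

end System

end CentralSystem

/-!
Every index `j ≥ 1` lies in exactly one block `2 ^ n ≤ j < 2 ^ (n + 1)`, so the system can be solved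
block by block: `x n` being known, `2 ^ n` new elements of `C` are needed whose sum plus `2 * x n` is
again in `C`. Choosing each block far beyond everything before it makes all entries distinct.
The difficulty is that the new elements must themselves admit a continuation.

Let `p` be a minimal idempotent containing `C`, viewed as an ultrafilter on `ℤ`, and for `A ∈ p` let
`H` be the set of `h` with `-h + A ∈ p`. Minimality makes `H` syndetic in `ℤ`
(`exists_finset_add_mem_returnSet`). Therefore the monoid `P` generated by `H` is a group of finite
index, `P ∈ p`, and there is a `k` such that every element of `P` is a sum of exactly `m` elements of
`H` whenever `m ≥ k` (`exists_uniform_sum_eq`). For `x ∈ A ∩ P` and `m ≥ k` write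
`-2 x = h₁ + ⋯ + hₘ`, and choose `uᵢ` one after the other so that `hᵢ + uᵢ ∈ A ∩ P` and
`u₁ + ⋯ + uₘ ∈ A`, which is possible because `p` is idempotent. Then `zᵢ = hᵢ + uᵢ` satisfy
`2 x + ∑ zᵢ ∈ A`. So `A ∩ P` reproduces itself for all block lengths `2 ^ n ≥ k`.

The finitely many shorter blocks are treated by shrinking the set once for each of them: for a given
`E ∈ p`, the number `2 x` is for `p`-almost all `x` a difference of two arbitrarily large elements of
`E` (`eventually_two_mul_difference`), which provides a block of length one, and idempotence prolongs
it to any length. The resulting increasing sets are those of `exists_levels`.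
-/

namespace CentralSystem

section Ultrafilters

attribute [local instance] Ultrafilter.addSemigroup

open Filter

variable {p : Ultrafilter ℤ}

/-! ### Minimal ultrafilters -/

/-- `βS` has an element that generates a minimal left ideal: any element of a minimal closed left
ideal will do, because the left ideals `βS + a` are closed. -/
theorem exists_forall_exists_add_add_eq (S : Type*) [AddSemigroup S] [Nonempty S] :
    ∃ z : Ultrafilter S, ∀ r : Ultrafilter S, ∃ s : Ultrafilter S, s + (r + z) = z := by
  let F : Set (Set (Ultrafilter S)) :=
    {L | IsClosed L ∧ L.Nonempty ∧ ∀ t : Ultrafilter S, ∀ a ∈ L, t + a ∈ L}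
  obtain ⟨L, hL⟩ : ∃ L, Minimal (· ∈ F) L := by
    refine zorn_superset F fun c hcF hc => ?_
    rcases c.eq_empty_or_nonempty with rfl | hne
    · exact ⟨Set.univ, ⟨isClosed_univ, Set.univ_nonempty, fun _ _ _ => trivial⟩, by simp⟩
    · refine ⟨⋂₀ c, ⟨isClosed_sInter fun s hs => (hcF hs).1, ?_,
        fun t a ha s hs => (hcF hs).2.2 t a (ha s hs)⟩, fun s hs => Set.sInter_subset_of_mem hs⟩
      have : Nonempty c := hne.to_subtype
      rw [Set.sInter_eq_iInter]
      refine IsCompact.nonempty_iInter_of_directed_nonempty_isCompact_isClosed _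
        (fun s t => ?_) (fun s => (hcF s.2).2.1)
        (fun s => (hcF s.2).1.isCompact) (fun s => (hcF s.2).1)
      rcases hc.total s.2 t.2 with h | h
      · exact ⟨s, subset_rfl, h⟩
      · exact ⟨t, h, subset_rfl⟩
  obtain ⟨z, hz⟩ := hL.prop.2.1
  refine ⟨z, fun r => ?_⟩
  have hmem : Set.range (· + (r + z)) ∈ F := by
    refine ⟨(isCompact_range (Ultrafilter.continuous_add_left _)).isClosed, ⟨_, r, rfl⟩, ?_⟩
    rintro t _ ⟨a, rfl⟩
    exact ⟨t + a, add_assoc _ _ _⟩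
  have hsub : Set.range (· + (r + z)) ⊆ L := by
    rintro _ ⟨a, rfl⟩
    exact hL.prop.2.2 _ _ (hL.prop.2.2 _ _ hz)
  exact hL.le_of_le hmem hsub hz

/-- Every `p ∈ K(βS)` lies in `βS + r + p` for all `r`, that is, `p` lies in a minimal left ideal. The
elements with this property form a two-sided ideal, so they include `K(βS)`. -/
theorem exists_add_eq_of_mem_smallestIdeal {S : Type*} [AddSemigroup S] [Nonempty S]
    {p : Ultrafilter S} (hp : p ∈ smallestIdeal (Ultrafilter S)) (r : Ultrafilter S) :
    ∃ s : Ultrafilter S, s + (r + p) = p := by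
  have hI : IsTwoSidedIdeal
      {z : Ultrafilter S | ∀ r : Ultrafilter S, ∃ s : Ultrafilter S, s + (r + z) = z} := by
    refine ⟨exists_forall_exists_add_add_eq S, fun t a ha r => ?_, fun t a ha r => ?_⟩
    · obtain ⟨s, hs⟩ := ha (r + t)
      exact ⟨t + s, by rw [← add_assoc r, add_assoc t, hs]⟩
    · obtain ⟨s, hs⟩ := ha r
      exact ⟨s, by rw [← add_assoc r, ← add_assoc s, hs]⟩
  exact hp _ hI r

/-- An idempotent ultrafilter on `ℤ` that contains every final segment and generates a minimal
left ideal of `βℤ`. -/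
structure IsMinimalIdempotentAtTop (p : Ultrafilter ℤ) : Prop where
  idem : p + p = p
  eventually_gt : ∀ M : ℤ, ∀ᶠ b in (p : Filter ℤ), M < b
  exists_add_eq : ∀ q : Ultrafilter ℤ, ∃ r : Ultrafilter ℤ, r + (q + p) = p

theorem map_add_map {S T : Type*} [AddSemigroup S] [AddSemigroup T] (f : S → T)
    (hf : ∀ a b, f (a + b) = f a + f b) (p q : Ultrafilter S) :
    p.map f + q.map f = (p + q).map f := by
  refine Ultrafilter.coe_injective (Filter.ext fun X => ?_)
  change (∀ᶠ x in ((p.map f + q.map f : Ultrafilter T) : Filter T), x ∈ X) ↔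
    ∀ᶠ x in ((p + q : Ultrafilter S) : Filter S), f x ∈ X
  rw [Ultrafilter.eventually_add, Ultrafilter.eventually_add]
  simp [Ultrafilter.coe_map, hf]

/-- Minimality survives the passage from `βℕ` to `βℤ`, since adding a nonprincipal ultrafilter on `ℕ`
to the right of any element of `βℤ` leads back into `βℕ`. -/
theorem isMinimalIdempotentAtTop_map {p : Ultrafilter ℕ+}
    (hp : p ∈ smallestIdeal (Ultrafilter ℕ+)) (hid : p + p = p) :
    IsMinimalIdempotentAtTop (p.map (fun n : ℕ+ => (n : ℤ))) := by
  have hadd : ∀ a b : ℕ+, ((a + b : ℕ+) : ℤ) = (a : ℤ) + b := fun a b => by push_cast; rfl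
  have hinj : Function.Injective (fun n : ℕ+ => (n : ℤ)) := fun a b h => by
    simpa using h
  have hgt : ∀ M : ℤ, ∀ᶠ b in (p.map (fun n : ℕ+ => (n : ℤ)) : Filter ℤ), M < b := by
    intro M
    change ∀ᶠ b : ℕ+ in (p : Filter ℕ+), M < (b : ℤ)
    by_contra h
    rw [← Ultrafilter.eventually_not] at h
    have hfin : {b : ℕ+ | ¬ M < (b : ℤ)}.Finite := by
      refine Set.Finite.of_finite_image ((Set.finite_Icc (0 : ℤ) M).subset ?_) hinj.injOn
      rintro _ ⟨b, hb, rfl⟩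
      exact ⟨by positivity, not_lt.1 hb⟩
    obtain ⟨a, -, ha⟩ := Ultrafilter.eq_pure_of_finite_mem hfin h
    have h1 : ∀ᶠ b in ((p + p : Ultrafilter ℕ+) : Filter ℕ+), b = a := by
      rw [hid, ha]; exact rfl
    rw [Ultrafilter.eventually_add, ha] at h1
    have h2 : a + a = a := h1
    have := congrArg (fun n : ℕ+ => (n : ℕ)) h2
    have := a.pos
    simp at *
  refine ⟨by rw [map_add_map _ hadd, hid], hgt, fun q => ?_⟩
  set P := p.map (fun n : ℕ+ => (n : ℤ)) with hP
  -- `q + P` contains the positive integers, hence lives on `ℕ+`.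
  have hpos : Set.range (fun n : ℕ+ => (n : ℤ)) ∈ q + P := by
    change ∀ᶠ x in ((q + P : Ultrafilter ℤ) : Filter ℤ), x ∈ Set.range (fun n : ℕ+ => (n : ℤ))
    rw [Ultrafilter.eventually_add]
    refine Eventually.of_forall fun a => (hgt (-a)).mono fun b hb => ?_
    exact ⟨⟨(a + b).toNat, by omega⟩, by simp; omega⟩
  obtain ⟨r, hr⟩ : ∃ r : Ultrafilter ℕ+, r.map (fun n : ℕ+ => (n : ℤ)) = q + P :=
    ⟨(q + P).comap hinj hpos, Ultrafilter.coe_injective (by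
      rw [Ultrafilter.coe_map, Ultrafilter.coe_comap, Filter.map_comap_of_mem hpos])⟩
  obtain ⟨s, hs⟩ := exists_add_eq_of_mem_smallestIdeal hp r
  refine ⟨s.map (fun n : ℕ+ => (n : ℤ)), ?_⟩
  have hPP : P + P = P := by rw [hP, map_add_map _ hadd, hid]
  calc s.map (fun n : ℕ+ => (n : ℤ)) + (q + P)
      = s.map (fun n : ℕ+ => (n : ℤ)) + ((q + P) + P) := by rw [add_assoc, hPP]
    _ = P := by rw [← hr, hP, map_add_map _ hadd, map_add_map _ hadd, hs]

/-! ### Return sets -/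

/-- The set of all `h` such that the translate `-h + A` belongs to `p`. For an idempotent `p`, a
partial sum `s` in `returnSet p A` is one that can be continued to an element of `A`. -/
def returnSet (p : Ultrafilter ℤ) (A : Set ℤ) : Set ℤ :=
  {h | ∀ᶠ b in (p : Filter ℤ), h + b ∈ A}

theorem zero_mem_returnSet {A : Set ℤ} (hA : A ∈ p) : (0 : ℤ) ∈ returnSet p A := by
  have : ∀ᶠ b in (p : Filter ℤ), b ∈ A := hA
  simpa [returnSet] using this

/-- As `0` is a return time, a sum of return times may be padded to any greater length. -/
theorem exists_sum_eq_of_mem_closure {A : Set ℤ} (hA : A ∈ p) {g : ℤ}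
    (hg : g ∈ AddSubmonoid.closure (returnSet p A)) :
    ∃ k : ℕ, ∃ c : ℕ → ℤ, (∀ i, c i ∈ returnSet p A) ∧
      ∀ m, k ≤ m → ∑ i ∈ Finset.range m, c i = g := by
  induction hg using AddSubmonoid.closure_induction_left with
  | zero => exact ⟨0, 0, fun _ => zero_mem_returnSet hA, by simp⟩
  | add_left h hh g _ ih =>
    obtain ⟨k, c, hc, hsum⟩ := ih
    refine ⟨k + 1, fun | 0 => h | i + 1 => c i, fun i => ?_, fun m hm => ?_⟩
    · cases i with
      | zero => exact hh
      | succ i => exact hc i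
    · obtain ⟨m, rfl⟩ : ∃ m', m = m' + 1 := ⟨m - 1, by omega⟩
      rw [Finset.sum_range_succ']
      simp only
      rw [hsum m (by omega), add_comm]

namespace IsMinimalIdempotentAtTop

theorem eventually_eventually (hp : IsMinimalIdempotentAtTop p) {Q : ℤ → Prop}
    (h : ∀ᶠ a in (p : Filter ℤ), Q a) :
    ∀ᶠ a in (p : Filter ℤ), ∀ᶠ b in (p : Filter ℤ), Q (a + b) := by
  rw [← hp.idem] at h
  exact (Ultrafilter.eventually_add _ _ _).1 h

theorem eventually_mem_returnSet (hp : IsMinimalIdempotentAtTop p) {A : Set ℤ} {s : ℤ}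
    (hs : s ∈ returnSet p A) : ∀ᶠ b in (p : Filter ℤ), s + b ∈ returnSet p A := by
  simpa [returnSet, add_assoc] using hp.eventually_eventually hs

/-- Return sets of members of a minimal ultrafilter are syndetic in `ℤ`. -/
theorem exists_finset_add_mem_returnSet (hp : IsMinimalIdempotentAtTop p) {A : Set ℤ}
    (hA : A ∈ p) : ∃ F : Finset ℤ, ∀ n : ℤ, ∃ f ∈ F, f + n ∈ returnSet p A := by
  -- Otherwise some `q` satisfies `A ∉ a + q + p` for every integer `a`, so `p ∉ βℤ + q + p`.
  by_contra! hcon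
  choose n hn using hcon
  let q : Ultrafilter ℤ := Ultrafilter.of (map n atTop)
  have hq : ∀ f : ℤ, ∀ᶠ k in (q : Filter ℤ), f + k ∉ returnSet p A := by
    intro f
    refine Ultrafilter.of_le (map n atTop) (?_ : ∀ᶠ F in atTop, f + n F ∉ returnSet p A)
    filter_upwards [eventually_ge_atTop {f}] with F hF
    exact hn F f (by simpa using hF)
  obtain ⟨r, hr⟩ := hp.exists_add_eq q
  have h : ∀ᶠ a in (p : Filter ℤ), a ∈ A := hA
  rw [← hr, Ultrafilter.eventually_add] at h
  obtain ⟨a, ha⟩ := h.exists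
  rw [Ultrafilter.eventually_add] at ha
  obtain ⟨k, hk, hk'⟩ := (ha.and (hq a)).exists
  exact hk' (by simpa [returnSet, add_assoc] using hk)

theorem neg_mem_closure_returnSet (hp : IsMinimalIdempotentAtTop p) {A : Set ℤ} (hA : A ∈ p)
    {g : ℤ} (hg : g ∈ AddSubmonoid.closure (returnSet p A)) :
    -g ∈ AddSubmonoid.closure (returnSet p A) := by
  obtain ⟨F, hF⟩ := hp.exists_finset_add_mem_returnSet hA
  obtain ⟨M, hM⟩ := F.bddAbove
  obtain ⟨m, hm⟩ := F.bddBelow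
  obtain ⟨f, hf, hu⟩ := hF (1 - m)
  obtain ⟨f', hf', hv⟩ := hF (-1 - M)
  have h1 : 0 < f + (1 - m) := by have := hm hf; omega
  have h2 : f' + (-1 - M) < 0 := by have := hM hf'; omega
  generalize f + (1 - m) = u at *
  generalize f' + (-1 - M) = v at *
  have hu' := AddSubmonoid.subset_closure hu
  have hv' := AddSubmonoid.subset_closure hv
  -- With `v < 0 < u` in the monoid, `-g` is `(-v - 1) g + g v` or `(u - 1) g + (-g) u`.
  rcases le_total 0 g with h | h
  · have := add_mem (AddSubmonoid.nsmul_mem _ hg (-v - 1).toNat)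
      (AddSubmonoid.nsmul_mem _ hv' g.toNat)
    convert this using 1
    simp only [nsmul_eq_mul]
    rw [← Int.cast_natCast, ← Int.cast_natCast, Int.toNat_of_nonneg (by omega),
      Int.toNat_of_nonneg h]
    simp only [Int.cast_id]
    ring
  · have := add_mem (AddSubmonoid.nsmul_mem _ hg (u - 1).toNat)
      (AddSubmonoid.nsmul_mem _ hu' (-g).toNat)
    convert this using 1
    simp only [nsmul_eq_mul]
    rw [← Int.cast_natCast, ← Int.cast_natCast, Int.toNat_of_nonneg (by omega),
      Int.toNat_of_nonneg (by omega)]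
    simp only [Int.cast_id]
    ring

/-- The group generated by a return set has finite index, so one of its cosets belongs to `p`; an
idempotent can only contain the trivial coset. -/
theorem closure_returnSet_mem (hp : IsMinimalIdempotentAtTop p) {A : Set ℤ} (hA : A ∈ p) :
    (AddSubmonoid.closure (returnSet p A) : Set ℤ) ∈ p := by
  set P := AddSubmonoid.closure (returnSet p A) with hP
  obtain ⟨F, hF⟩ := hp.exists_finset_add_mem_returnSet hA
  obtain ⟨f, -, hf⟩ : ∃ f ∈ F, ∀ᶠ n in (p : Filter ℤ), f + n ∈ P := by
    have : (⋃ f ∈ (F : Set ℤ), {n : ℤ | f + n ∈ P}) ∈ p := by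
      refine Filter.mem_of_superset Filter.univ_mem fun n _ => ?_
      obtain ⟨f, hf, h⟩ := hF n
      simp only [Set.mem_iUnion]
      exact ⟨f, hf, AddSubmonoid.subset_closure h⟩
    exact (Ultrafilter.finite_biUnion_mem_iff F.finite_toSet).1 this
  obtain ⟨a, ha, ha'⟩ := ((hp.eventually_eventually hf).and hf).exists
  obtain ⟨b, hb, hb'⟩ := (ha.and hf).exists
  have hf0 : -f ∈ P := by
    have := add_mem hb (hp.neg_mem_closure_returnSet hA (add_mem ha' hb'))
    convert this using 1
    ring
  refine hf.mono fun n hn => ?_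
  have := add_mem hf0 hn
  rwa [neg_add_cancel_left] at this

/-- There is a `k` such that every element of the group generated by the return set is a sum of `m`
return times for all `m ≥ k`: a single return time takes it into a fixed finite set. -/
theorem exists_uniform_sum_eq (hp : IsMinimalIdempotentAtTop p) {A : Set ℤ} (hA : A ∈ p) :
    ∃ k : ℕ, ∀ g ∈ AddSubmonoid.closure (returnSet p A), ∃ c : ℕ → ℤ,
      (∀ i, c i ∈ returnSet p A) ∧ ∀ m, k ≤ m → ∑ i ∈ Finset.range m, c i = g := by
  obtain ⟨F, hF⟩ := hp.exists_finset_add_mem_returnSet hA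
  have key : ∀ f : ℤ, ∃ k : ℕ, -f ∈ AddSubmonoid.closure (returnSet p A) →
      ∃ c : ℕ → ℤ, (∀ i, c i ∈ returnSet p A) ∧
        ∀ m, k ≤ m → ∑ i ∈ Finset.range m, c i = -f := by
    intro f
    by_cases h : -f ∈ AddSubmonoid.closure (returnSet p A)
    · obtain ⟨k, hk⟩ := exists_sum_eq_of_mem_closure hA h
      exact ⟨k, fun _ => hk⟩
    · exact ⟨0, fun h' => absurd h' h⟩
  choose k hk using key
  refine ⟨F.sup k + 1, fun g hg => ?_⟩
  obtain ⟨f, hf, hr⟩ := hF g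
  have hf' : -f ∈ AddSubmonoid.closure (returnSet p A) := by
    have := add_mem hg (hp.neg_mem_closure_returnSet hA (AddSubmonoid.subset_closure hr))
    convert this using 1
    ring
  obtain ⟨c, hc, hsum⟩ := hk f hf'
  have hle : k f ≤ F.sup k := Finset.le_sup hf
  refine ⟨fun | 0 => f + g | i + 1 => c i, fun i => ?_, fun m hm => ?_⟩
  · cases i with
    | zero => exact hr
    | succ i => exact hc i
  · obtain ⟨m, rfl⟩ : ∃ m', m = m' + 1 := ⟨m - 1, by omega⟩
    rw [Finset.sum_range_succ']
    simp only
    rw [hsum m (by omega)]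
    ring

/-! ### Extending a solution by one block -/

/-- A sequence of return times `cᵢ` of `A` can be approximated from within `A`: there are `zᵢ ∈ A` such
that every nonempty partial sum of the `zᵢ - cᵢ`, started at `s`, lies in `B`. Each difference
`zᵢ - cᵢ` is chosen generic for `p`. -/
theorem exists_strictMono_sums (hp : IsMinimalIdempotentAtTop p) {A B : Set ℤ}
    {c : ℕ → ℤ} (hc : ∀ i, c i ∈ returnSet p A) {s : ℤ} (hs : s ∈ returnSet p B) (M : ℤ) :
    ∃ z : ℕ → ℤ, StrictMono z ∧ (∀ i, z i ∈ A ∧ M < z i) ∧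
      ∀ m, s + ∑ i ∈ Finset.range (m + 1), (z i - c i) ∈ B := by
  have step : ∀ (i : ℕ) (N t : ℤ), t ∈ returnSet p B →
      ∃ z : ℤ, z ∈ A ∧ N < z ∧ t + (z - c i) ∈ B ∧ t + (z - c i) ∈ returnSet p B := by
    intro i N t ht
    obtain ⟨u, h1, h2, h3, h4⟩ := ((hc i).and ((hp.eventually_gt (N - c i)).and
      (ht.and (hp.eventually_mem_returnSet ht)))).exists
    have hu : c i + u - c i = u := by ring
    exact ⟨c i + u, h1, by linarith, by rwa [hu], by rwa [hu]⟩
  choose f hfA hfN hfB hfR using step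
  -- The state after `i` steps is the last term together with the current partial sum.
  let σ : ℕ → ℤ × {t : ℤ // t ∈ returnSet p B} := fun n =>
    Nat.rec (M, ⟨s, hs⟩)
      (fun i st => (f i st.1 st.2.1 st.2.2, ⟨_, hfR i st.1 st.2.1 st.2.2⟩)) n
  have hgt : ∀ i, (σ i).1 < (σ (i + 1)).1 := fun i => hfN i _ _ _
  have hmono : StrictMono fun i => (σ i).1 := strictMono_nat_of_lt_succ hgt
  have hsum : ∀ m, ((σ m).2 : ℤ) = s + ∑ i ∈ Finset.range m, ((σ (i + 1)).1 - c i) := by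
    intro m
    induction m with
    | zero => simp [σ]
    | succ m ih => rw [Finset.sum_range_succ, ← add_assoc, ← ih]
  refine ⟨fun i => (σ (i + 1)).1, fun i j h => hmono (Nat.succ_lt_succ h),
    fun i => ⟨hfA i _ _ _, hmono (Nat.succ_pos i)⟩, fun m => ?_⟩
  rw [← hsum]
  exact hfB m _ _ _

/-- For `p`-almost all `x`, the number `2 x` is a difference of two elements of `E`, the smaller of them
arbitrarily large. Some translate `f + 2 x` is `p`-almost surely a return time of `E`, and
`2 x = (f + 2 (x + x')) - (f + 2 x')`. -/
theorem eventually_two_mul_difference (hp : IsMinimalIdempotentAtTop p) {E : Set ℤ} (hE : E ∈ p) :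
    ∀ᶠ x in (p : Filter ℤ), ∀ M : ℤ, ∃ z ∈ E, M < z ∧ 2 * x + z ∈ E := by
  obtain ⟨F, hF⟩ := hp.exists_finset_add_mem_returnSet hE
  obtain ⟨f, -, hf⟩ : ∃ f ∈ F, ∀ᶠ x in (p : Filter ℤ), f + 2 * x ∈ returnSet p E := by
    have : (⋃ f ∈ (F : Set ℤ), {x : ℤ | f + 2 * x ∈ returnSet p E}) ∈ p := by
      refine Filter.mem_of_superset Filter.univ_mem fun x _ => ?_
      obtain ⟨f, hf, h⟩ := hF (2 * x)
      simp only [Set.mem_iUnion]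
      exact ⟨f, hf, h⟩
    exact (Ultrafilter.finite_biUnion_mem_iff F.finite_toSet).1 this
  refine (hp.eventually_eventually hf).mono fun x hx M => ?_
  obtain ⟨x', h1, h2⟩ := (hx.and hf).exists
  obtain ⟨b, hb1, hb2, hb⟩ := (h1.and (h2.and (hp.eventually_gt (M - (f + 2 * x'))))).exists
  refine ⟨f + 2 * x' + b, hb2, by linarith, ?_⟩
  convert hb1 using 1
  ring

end IsMinimalIdempotentAtTop

/-- `Extends B D m x` says that the equation `2 x + z₀ + ⋯ + z_{m-1} = y` can be solved with `y ∈ B`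
and distinct `zᵢ ∈ D` beyond any prescribed bound. The `zᵢ` are the first `m` terms of an infinite
increasing sequence in `D`; the later terms play no role. -/
def Extends (B D : Set ℤ) (m : ℕ) (x : ℤ) : Prop :=
  ∀ M : ℤ, ∃ z : ℕ → ℤ, StrictMono z ∧ (∀ i, z i ∈ D ∧ M < z i) ∧
    2 * x + ∑ i ∈ Finset.range m, z i ∈ B

/-- Increasing sets `B n ∈ p` such that each `x ∈ B n` can serve as the term `x n`, its block being
chosen from `B (n + 1)`. The sequence is built downwards from a set that reproduces itself for all
large block lengths. -/
theorem IsMinimalIdempotentAtTop.exists_levels (hp : IsMinimalIdempotentAtTop p)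
    {A : Set ℤ} (hA : A ∈ p) :
    ∃ B : ℕ → Set ℤ, (∀ n, B n ∈ p) ∧ Monotone B ∧ (∀ n, B n ⊆ A) ∧
      ∀ n, ∀ x ∈ B n, Extends A (B (n + 1)) (2 ^ n) x := by
  set P := AddSubmonoid.closure (returnSet p A) with hP
  have hPp : (P : Set ℤ) ∈ p := hp.closure_returnSet_mem hA
  set D : Set ℤ := A ∩ P with hD
  have hDp : D ∈ p := Filter.inter_mem hA hPp
  have hret : returnSet p A ⊆ returnSet p D := by
    intro h hh
    filter_upwards [hh, hPp] with b hb hb'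
    exact ⟨hb, add_mem (AddSubmonoid.subset_closure hh) hb'⟩
  obtain ⟨k, hk⟩ := hp.exists_uniform_sum_eq hA
  -- From level `k` on, `D` reproduces itself.
  have hstable : ∀ m, k ≤ m → 0 < m → ∀ x ∈ D, Extends A D m x := by
    intro m hm hm0 x hx M
    -- With `-2 x = c₀ + ⋯ + c_{m-1}`, the value `2 x + ∑ zᵢ` is the sum of the generic `zᵢ - cᵢ`.
    obtain ⟨c, hc, hsum⟩ := hk (-(2 * x)) (hp.neg_mem_closure_returnSet hA
      (by rw [two_mul]; exact add_mem hx.2 hx.2))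
    obtain ⟨z, hz, hzD, hzB⟩ := hp.exists_strictMono_sums (fun i => hret (hc i))
      (zero_mem_returnSet hA) M
    refine ⟨z, hz, hzD, ?_⟩
    have := hzB (m - 1)
    rw [Nat.sub_add_cancel hm0, Finset.sum_sub_distrib, hsum m hm] at this
    convert this using 1
    ring
  -- Going down a level, keep the `x` that extend into the current set. This stays in `p`: write
  -- `2 x + z₀ = y` and enlarge `y` by further elements to reach the required block length.
  let L : ℕ → Set ℤ := fun i => Nat.rec D (fun _ B => {x ∈ B | ∀ m, 0 < m → Extends A B m x}) i
  have hLanti : Antitone L := antitone_nat_of_succ_le fun i x hx => hx.1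
  have hLD : ∀ i, L i ⊆ D := fun i => hLanti (Nat.zero_le i)
  have hLp : ∀ i, L i ∈ p := by
    intro i
    induction i with
    | zero => exact hDp
    | succ i ih =>
      have hE : {x ∈ L i | x ∈ returnSet p (L i)} ∈ p :=
        Filter.inter_mem ih (by
          simpa using hp.eventually_mem_returnSet (zero_mem_returnSet ih))
      filter_upwards [ih, hp.eventually_two_mul_difference hE] with x hx hx'
      refine ⟨hx, fun m hm M => ?_⟩
      obtain ⟨z₀, hz₀, hM, hy⟩ := hx' M
      obtain ⟨z, hz, hzL, hzB⟩ := hp.exists_strictMono_sums (c := 0)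
        (fun _ => zero_mem_returnSet ih) hy.2 z₀
      refine ⟨fun | 0 => z₀ | j + 1 => z j, strictMono_nat_of_lt_succ fun j => ?_,
        fun j => ?_, ?_⟩
      · cases j with
        | zero => exact (hzL 0).2
        | succ j => exact hz (Nat.lt_succ_self j)
      · cases j with
        | zero => exact ⟨hz₀.1, hM⟩
        | succ j => exact ⟨(hzL j).1, hM.trans (hzL j).2⟩
      · obtain ⟨m, rfl⟩ : ∃ m', m = m' + 1 := ⟨m - 1, by omega⟩
        rw [Finset.sum_range_succ']
        simp only
        cases m with
        | zero => simpa using (hLD i hy.1).1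
        | succ m =>
          have := (hLD i (hzB m)).1
          simp only [Pi.zero_apply, sub_zero] at this
          convert this using 1
          ring
  refine ⟨fun n => L (k - n), fun n => hLp _, fun a b h => hLanti (by omega),
    fun n => (hLD _).trans Set.inter_subset_left, fun n x hx => ?_⟩
  rcases lt_or_ge n k with h | h
  · have hkn : k - n = (k - (n + 1)) + 1 := by omega
    simp only [hkn] at hx
    exact hx.2 _ (by positivity)
  · have h1 : k - n = 0 := by omega
    have h2 : k - (n + 1) = 0 := by omega
    simp only [h1, h2] at hx ⊢
    exact hstable _ (h.trans n.lt_two_pow_self.le) (by positivity) x hx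

/-! ### Assembling the blocks -/

/-- Concatenating blocks: block `n` occupies the indices from `2 ^ n` to `2 ^ (n + 1) - 1`, and each
of its terms exceeds twice the sum of the terms before the block, so (for positive terms) also every
earlier value `y`. -/
theorem exists_seq_mem_of_extends {A : Set ℤ} {B : ℕ → Set ℤ} (hB : Monotone B)
    (hext : ∀ n, ∀ x ∈ B n, Extends A (B (n + 1)) (2 ^ n) x) {a : ℤ} (ha : a ∈ B 0) :
    ∃ x : ℕ → ℤ, x 0 = a ∧ (∀ j, x j ∈ B j) ∧
      ∀ n, ∃ z : ℕ → ℤ, StrictMono z ∧ (∀ i < 2 ^ n, x (2 ^ n + i) = z i) ∧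
        (∀ i, 2 * ∑ j ∈ Finset.range (2 ^ n), x j < z i) ∧
        2 * x n + ∑ i ∈ Finset.range (2 ^ n), x (2 ^ n + i) ∈ A := by
  have hext' : ∀ (n : ℕ) (x M : ℤ), ∃ z : ℕ → ℤ, x ∈ B n → StrictMono z ∧
      (∀ i, z i ∈ B (n + 1) ∧ M < z i) ∧ 2 * x + ∑ i ∈ Finset.range (2 ^ n), z i ∈ A := by
    intro n x M
    by_cases hx : x ∈ B n
    · obtain ⟨z, hz⟩ := hext n x hx M
      exact ⟨z, fun _ => hz⟩
    · exact ⟨0, fun h => absurd h hx⟩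
  choose Z hZ using hext'
  -- `f n` carries the terms with index below `2 ^ n`; its other values are irrelevant.
  let f : ℕ → ℕ → ℤ := fun n => Nat.rec (fun _ => a) (fun n g j => if j < 2 ^ n then g j else
    Z n (g n) (2 * ∑ i ∈ Finset.range (2 ^ n), g i) (j - 2 ^ n)) n
  have hf : ∀ n j, f (n + 1) j = if j < 2 ^ n then f n j else
    Z n (f n n) (2 * ∑ i ∈ Finset.range (2 ^ n), f n i) (j - 2 ^ n) := fun _ _ => rfl
  have hfB : ∀ n, ∀ j < 2 ^ n, f n j ∈ B j := by
    intro n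
    induction n with
    | zero =>
      intro j hj
      obtain rfl : j = 0 := by simpa using hj
      exact ha
    | succ n ih =>
      intro j _
      rw [hf]
      split_ifs with h
      · exact ih j h
      · have hn := n.lt_two_pow_self
        exact hB (by omega) ((hZ n _ _ (ih n hn)).2.1 _).1
  have hstab : ∀ n m, n ≤ m → ∀ j < 2 ^ n, f m j = f n j := by
    intro n m hnm j hj
    induction m, hnm using Nat.le_induction with
    | base => rfl
    | succ m hnm ih =>
      rw [hf, if_pos (hj.trans_le (Nat.pow_le_pow_right two_pos hnm)), ih]
  have hx : ∀ n, ∀ j < 2 ^ n, f n j = f j j := by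
    intro n j hj
    rcases le_total n j with h | h
    · exact (hstab n j h j hj).symm
    · exact hstab j n h j j.lt_two_pow_self
  refine ⟨fun j => f j j, rfl, fun j => hfB j j j.lt_two_pow_self, fun n => ?_⟩
  have hsum : ∑ i ∈ Finset.range (2 ^ n), f n i = ∑ i ∈ Finset.range (2 ^ n), f i i :=
    Finset.sum_congr rfl fun i hi => hx n i (Finset.mem_range.1 hi)
  have hnew : ∀ i < 2 ^ n, f (2 ^ n + i) (2 ^ n + i) =
      Z n (f n n) (2 * ∑ i ∈ Finset.range (2 ^ n), f n i) i := by
    intro i hi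
    rw [← hx (n + 1) (2 ^ n + i) (by rw [pow_succ]; omega), hf, if_neg (by omega),
      Nat.add_sub_cancel_left]
  obtain ⟨h1, h2, h3⟩ := hZ n (f n n) (2 * ∑ i ∈ Finset.range (2 ^ n), f n i)
    (hfB n n n.lt_two_pow_self)
  refine ⟨_, h1, hnew, fun i => ?_, ?_⟩
  · simp only
    rw [← hsum]
    exact (h2 i).2
  · simp only
    rwa [Finset.sum_congr rfl fun i hi => hnew i (Finset.mem_range.1 hi)]

theorem IsMinimalIdempotentAtTop.exists_separated_solution (hp : IsMinimalIdempotentAtTop p)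
    {A : Set ℤ} (hA : A ∈ p) :
    ∃ x y : ℕ → ℤ, (∀ n, x n ∈ A) ∧ (∀ n, y n ∈ A) ∧
      (∀ n, y n = 2 * x n + ∑ i ∈ Finset.range (2 ^ n), x (2 ^ n + i)) ∧
      Function.Injective x ∧ Function.Injective y ∧ ∀ m n, x m ≠ y n := by
  obtain ⟨B, hBp, hB, hBA, hext⟩ := hp.exists_levels hA
  obtain ⟨a, haB, ha⟩ := ((hp.eventually_gt 0).and (hBp 0)).exists
  obtain ⟨x, hx0, hxB, hblock⟩ := exists_seq_mem_of_extends hB hext ha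
  choose z hzmono hxz hzgt hyA using hblock
  have hpow : ∀ j : ℕ, 0 < j → ∃ n, ∃ i < 2 ^ n, j = 2 ^ n + i := by
    intro j hj
    have h1 := Nat.pow_log_le_self 2 hj.ne'
    have h2 := Nat.lt_pow_succ_log_self one_lt_two j
    rw [pow_succ] at h2
    exact ⟨Nat.log 2 j, j - 2 ^ Nat.log 2 j, by omega, by omega⟩
  have hpos : ∀ j, 0 < x j := by
    intro j
    induction j using Nat.strong_induction_on with
    | _ j ih =>
      rcases Nat.eq_zero_or_pos j with rfl | hj
      · rwa [hx0]
      · obtain ⟨n, i, hi, rfl⟩ := hpow j hj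
        rw [hxz n i hi]
        refine lt_of_le_of_lt ?_ (hzgt n i)
        exact mul_nonneg two_pos.le (Finset.sum_nonneg fun j hj =>
          (ih j (by have := Finset.mem_range.1 hj; omega)).le)
  have hle : ∀ n, ∀ j < n, x j ≤ ∑ i ∈ Finset.range n, x i := fun n j hj =>
    Finset.single_le_sum (fun i _ => (hpos i).le) (Finset.mem_range.2 hj)
  have hnext : ∀ n, 2 * ∑ j ∈ Finset.range (2 ^ n), x j < x (2 ^ n) := by
    intro n
    have h := hxz n 0 (by positivity)
    rw [add_zero] at h
    rw [h]
    exact hzgt n 0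
  have hmono : StrictMono x := by
    refine strictMono_nat_of_lt_succ fun j => ?_
    obtain ⟨n, i, hi, hj⟩ := hpow (j + 1) j.succ_pos
    cases i with
    | zero =>
      have h1 := hle (2 ^ n) j (by omega)
      have h2 := hnext n
      have h3 := hpos j
      rw [hj, add_zero]
      linarith
    | succ i =>
      obtain rfl : j = 2 ^ n + i := by omega
      rw [hj, hxz n i (by omega), hxz n _ hi]
      exact hzmono n i.lt_succ_self
  set y : ℕ → ℤ := fun n => 2 * x n + ∑ i ∈ Finset.range (2 ^ n), x (2 ^ n + i) with hy
  have hxy : ∀ n, ∀ j < 2 ^ (n + 1), x j < y n := by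
    intro n j hj
    have h0 : 0 < 2 ^ n := by positivity
    have h1 : x j ≤ x (2 ^ n + (2 ^ n - 1)) := hmono.monotone (by rw [pow_succ] at hj; omega)
    have h2 : x (2 ^ n + (2 ^ n - 1)) ≤ ∑ i ∈ Finset.range (2 ^ n), x (2 ^ n + i) :=
      Finset.single_le_sum (f := fun i => x (2 ^ n + i)) (fun i _ => (hpos _).le)
        (Finset.mem_range.2 (by omega))
    have h3 := hpos n
    simp only [hy]
    linarith
  have hyx : ∀ n, y n < x (2 ^ (n + 1)) := by
    intro n
    have h1 := hnext (n + 1)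
    rw [show 2 ^ (n + 1) = 2 ^ n + 2 ^ n by ring, Finset.sum_range_add] at h1
    rw [show 2 ^ (n + 1) = 2 ^ n + 2 ^ n by ring]
    have h2 := hle (2 ^ n) n n.lt_two_pow_self
    have h3 : 0 ≤ ∑ i ∈ Finset.range (2 ^ n), x (2 ^ n + i) :=
      Finset.sum_nonneg fun i _ => (hpos _).le
    simp only [hy]
    linarith
  have hymono : StrictMono y := strictMono_nat_of_lt_succ fun n =>
    (hyx n).trans (hxy (n + 1) _ (Nat.pow_lt_pow_right one_lt_two (by omega)))
  refine ⟨x, y, fun n => hBA n (hxB n), hyA, fun _ => rfl, hmono.injective, hymono.injective,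
    fun m n => ?_⟩
  rcases lt_or_ge m (2 ^ (n + 1)) with h | h
  · exact (hxy n m h).ne
  · exact ((hyx n).trans_le (hmono.monotone h)).ne'

end Ultrafilters

/-! ### The system of equations -/

theorem mulVecRowFinite_coeffMatrix (u v : ℕ → ℚ) (n : ℕ) :
    mulVecRowFinite coeffMatrix (Sum.elim u v) n =
      2 * u n + ∑ i ∈ Finset.range (2 ^ n), u (2 ^ n + i) - v n := by
  have hn : n < 2 ^ n := n.lt_two_pow_self
  rw [mulVecRowFinite, finsum_eq_sum_of_support_subset
    (s := (Finset.range (2 ^ n + 2 ^ n)).disjSum {n})]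
  · rw [Finset.sum_disjSum, Finset.sum_range_add, Finset.sum_singleton,
      Finset.sum_eq_single_of_mem n (Finset.mem_range.2 hn)]
    · have h : ∀ i ∈ Finset.range (2 ^ n), coeffMatrix n (Sum.inl (2 ^ n + i)) *
          Sum.elim u v (Sum.inl (2 ^ n + i)) = u (2 ^ n + i) := by
        intro i hi
        have := Finset.mem_range.1 hi
        have h2 : 2 ^ n + i < 2 ^ (n + 1) := by rw [pow_succ]; omega
        simp [coeffMatrix, matA, h2, show 2 ^ n + i ≠ n by omega]
      rw [Finset.sum_congr rfl h]
      simp [coeffMatrix, matA]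
      ring
    · intro j hj hjn
      have := Finset.mem_range.1 hj
      simp [coeffMatrix, matA, hjn, this]
  · refine (Function.support_subset_iff'.2 fun j hj => ?_)
    by_contra h
    have hsupp : coeffMatrix n j ≠ 0 := fun h0 => h (by rw [h0, zero_mul])
    rcases j with j | j
    · have hj' : 2 ^ n + 2 ^ n ≤ j := by simpa using hj
      apply hsupp
      simp [coeffMatrix, matA, show j ≠ n by omega, pow_succ]
      omega
    · have hj' : j ≠ n := by simpa using hj
      exact hsupp (by simp [coeffMatrix, hj'.symm])

end CentralSystem

theorem corollary3p7 (C : Set ℕ+) (hC : CentralSystem.IsCentral C) :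
    ∃ x y : ℕ → ℕ+, (∀ n, x n ∈ C) ∧ (∀ n, y n ∈ C) ∧
      CentralSystem.mulVecRowFinite CentralSystem.coeffMatrix
        (Sum.elim (fun n => ((x n : ℕ) : ℚ)) (fun n => ((y n : ℕ) : ℚ))) = 0 ∧
      Function.Injective (Sum.elim x y) := by
  obtain ⟨p, hpK, hid, hCp⟩ := hC
  have hp := CentralSystem.isMinimalIdempotentAtTop_map hpK hid
  have hA : (fun n : ℕ+ => (n : ℤ)) '' C ∈ p.map (fun n : ℕ+ => (n : ℤ)) :=
    Filter.image_mem_map hCp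
  obtain ⟨x, y, hx, hy, heq, hxi, hyi, hxy⟩ := hp.exists_separated_solution hA
  choose X hXC hX using hx
  choose Y hYC hY using hy
  simp only at hX hY
  refine ⟨X, Y, hXC, hYC, funext fun n => ?_, Function.Injective.sumElim
    (fun a b h => hxi ?_) (fun a b h => hyi ?_) fun a b h => hxy a b ?_⟩
  · have h := heq n
    simp only [← hX, ← hY] at h
    rw [CentralSystem.mulVecRowFinite_coeffMatrix, Pi.zero_apply, sub_eq_zero]
    exact_mod_cast h.symm
  · rw [← hX, ← hX, h]
  · rw [← hY, ← hY, h]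
  · rw [← hX, ← hY, h]
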